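/- Let $r, d$ be positive integers and let $\mathcal{F} = (F_i)_{i \in I}$ be a family (repetitions allowed) of $(r-1)\left(\frac{d(d+3)}{2}+1\right)+1$ sets of volume (Lebesgue measure) one in $\mathbb{R}^d$. Then $\mathcal{F}$ can be partitioned into $r$ nonempty parts $\mathcal{A}_1, \ldots, \mathcal{A}_r$ such that $$\operatorname{vol}\left(\bigcap_{j=1}^r \operatorname{conv}\left(\bigcup \mathcal{A}_j\right)\right) \ge d^{-d},$$ where $\bigcup \mathcal{A}_j$ denotes the union of the sets in $\mathcal{A}_j$ and $\operatorname{conv}$ denotes the convex hull. -/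

import Mathlib

open MeasureTheory

/-! The proof is Tverberg's theorem in a space of ellipsoids. Fix `h > d`. By an approximate John
theorem (`Convex.exists_ellipsoid_subset`) each hull `conv F i` contains an ellipsoid `c + L B`, `B`
the unit ball, of volume at least `h⁻ᵈ`. Gram–Schmidt makes `L` lower triangular with positive
diagonal, so the pairs `(c, L)` live in dimension `d + d(d+1)/2 = d(d+3)/2`, and
`exists_tverberg_partition` gives a partition whose parts have a common point `v` in the hulls of
their parameters.

For convex `K`, the parameters of ellipsoids in `K` of at least a given volume form a convex set
(`Convex.convex_ellipsoidsIn`). So the single ellipsoid of `v` lies in every `conv (⋃ A j)`. Since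
there are finitely many partitions, `h` can be lowered to `d`. -/

/-! ### Colorful Carathéodory theorem -/

/-- Affinely independent points on an affine hyperplane missing the origin number at most the
dimension. -/
theorem AffineIndependent.card_le_finrank_of_inner_eq {E : Type*} [NormedAddCommGroup E]
    [InnerProductSpace ℝ E] [FiniteDimensional ℝ E] {κ : Type*} [Fintype κ] {x : κ → E}
    (hx : AffineIndependent ℝ x) {z : E} (hz : z ≠ 0) {a : ℝ} (hxz : ∀ i, inner ℝ z (x i) = a) :
    Fintype.card κ ≤ Module.finrank ℝ E := by
  rcases isEmpty_or_nonempty κ with h | h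
  · simp
  have h1 := hx.finrank_vectorSpan_add_one
  have h2 : vectorSpan ℝ (Set.range x) ≤ (ℝ ∙ z)ᗮ := by
    rw [vectorSpan_def, Submodule.span_le]
    rintro _ ⟨_, ⟨i, rfl⟩, _, ⟨j, rfl⟩, rfl⟩
    rw [SetLike.mem_coe, Submodule.mem_orthogonal_singleton_iff_inner_right]
    simp [inner_sub_right, hxz]
  have h3 := Submodule.finrank_mono h2
  have h4 := Submodule.finrank_add_finrank_orthogonal (ℝ ∙ z)
  rw [finrank_span_singleton hz] at h4
  omega

/-- A convex set containing `z ≠ 0` and a point `x` with `⟪z, x⟫ ≤ 0` contains a point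
of norm smaller than that of `z`. -/
theorem Convex.exists_norm_lt_of_inner_nonpos {E : Type*} [NormedAddCommGroup E]
    [InnerProductSpace ℝ E] {C : Set E} (hC : Convex ℝ C) {z x : E} (hzC : z ∈ C) (hxC : x ∈ C)
    (hz : z ≠ 0) (hzx : inner ℝ z x ≤ 0) : ∃ y ∈ C, ‖y‖ < ‖z‖ := by
  by_contra! h
  have h0 : ∀ w ∈ C, ‖(0 : E) - z‖ ≤ ‖(0 : E) - w‖ := fun w hw => by simpa using h w hw
  have h1 : ‖(0 : E) - z‖ = ⨅ w : C, ‖(0 : E) - w‖ := by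
    have : Nonempty C := ⟨⟨z, hzC⟩⟩
    refine le_antisymm (le_ciInf fun w => h0 w w.2) ?_
    exact ciInf_le ⟨0, by rintro _ ⟨w, rfl⟩; exact norm_nonneg _⟩ (⟨z, hzC⟩ : C)
  have h2 := (norm_eq_iInf_iff_real_inner_le_zero hC hzC).1 h1 x hxC
  have h3 : 0 < inner ℝ z z := real_inner_self_pos.2 hz
  simp only [zero_sub, inner_neg_left, inner_sub_right] at h2
  linarith

/-- If the points `g i` outnumber the dimension, then a point `z ≠ 0` of least norm in their convex
hull is already in the convex hull of all but one of them. -/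
theorem exists_mem_convexHull_image_compl_of_isMinOn_norm {E : Type*} [NormedAddCommGroup E]
    [InnerProductSpace ℝ E] [FiniteDimensional ℝ E] {ι : Type*} [Fintype ι] (g : ι → E)
    (hι : Module.finrank ℝ E < Fintype.card ι) {z : E} (hz : z ≠ 0)
    (hzg : z ∈ convexHull ℝ (Set.range g)) (hmin : ∀ y ∈ convexHull ℝ (Set.range g), ‖z‖ ≤ ‖y‖) :
    ∃ i₀, z ∈ convexHull ℝ (g '' {i | i ≠ i₀}) := by
  obtain ⟨κ, _, x, w, hxr, hx, hw, hw1, hwz⟩ := eq_pos_convex_span_of_mem_convexHull hzg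
  have hxi : ∀ i, inner ℝ z z ≤ inner ℝ z (x i) := by
    intro i
    by_contra! hlt
    have hxC : x i ∈ convexHull ℝ (Set.range g) := subset_convexHull ℝ _ (hxr ⟨i, rfl⟩)
    have hne : Nonempty (convexHull ℝ (Set.range g)) := ⟨⟨z, hzg⟩⟩
    have h1 : ‖(0 : E) - z‖ = ⨅ w : convexHull ℝ (Set.range g), ‖(0 : E) - w‖ := by
      refine le_antisymm (le_ciInf fun w => by simpa using hmin w w.2) ?_
      exact ciInf_le ⟨0, by rintro _ ⟨w, rfl⟩; exact norm_nonneg _⟩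
        (⟨z, hzg⟩ : convexHull ℝ (Set.range g))
    have h2 := (norm_eq_iInf_iff_real_inner_le_zero (convex_convexHull ℝ _) hzg).1 h1 _ hxC
    simp only [zero_sub, inner_neg_left, inner_sub_right] at h2
    linarith
  -- A positive average of points in a closed half-space lies on its boundary only if all the points
  -- do. Affine independence then bounds their number by the dimension, so some index is not needed.
  have hsum : ∑ i, w i * (inner ℝ z (x i) - inner ℝ z z) = 0 := by
    have : inner ℝ z (∑ i, w i • x i) = inner ℝ z z := by rw [hwz]
    simp only [inner_sum, inner_smul_right] at this
    simp only [mul_sub, Finset.sum_sub_distrib, this, ← Finset.sum_mul, hw1, one_mul, sub_self]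
  have hxe : ∀ i, inner ℝ z (x i) = inner ℝ z z := by
    intro i
    have := (Finset.sum_eq_zero_iff_of_nonneg fun i _ =>
      mul_nonneg (hw i).le (sub_nonneg.2 (hxi i))).1 hsum i (Finset.mem_univ i)
    rcases mul_eq_zero.1 this with h | h
    · exact absurd h (hw i).ne'
    · linarith
  have hcard := hx.card_le_finrank_of_inner_eq hz hxe
  choose p hp using fun i => hxr ⟨i, rfl⟩
  have hns : ¬ Function.Surjective p := fun hs => by
    have := Fintype.card_le_of_surjective p hs
    omega
  simp only [Function.Surjective, not_forall, not_exists] at hns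
  obtain ⟨i₀, hi₀⟩ := hns
  refine ⟨i₀, ?_⟩
  rw [← hwz]
  refine (convex_convexHull ℝ _).sum_mem (fun i _ => (hw i).le) hw1 fun i _ => ?_
  exact subset_convexHull ℝ _ ⟨p i, hi₀ i, hp i⟩

/-- **Colorful Carathéodory theorem**, for inner product spaces. -/
theorem exists_zero_mem_convexHull_rainbow {E : Type*} [NormedAddCommGroup E]
    [InnerProductSpace ℝ E] [FiniteDimensional ℝ E] {ι κ : Type*} [Fintype ι] [Finite κ]
    (X : ι → κ → E) (hι : Module.finrank ℝ E < Fintype.card ι)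
    (hX : ∀ i, (0 : E) ∈ convexHull ℝ (Set.range (X i))) :
    ∃ f : ι → κ, (0 : E) ∈ convexHull ℝ (Set.range fun i => X i (f i)) := by
  classical
  have hκ : Nonempty (ι → κ) := by
    refine ⟨fun i => ?_⟩
    have : (Set.range (X i)).Nonempty := convexHull_nonempty_iff.1 ⟨0, hX i⟩
    exact (Set.range_nonempty_iff_nonempty.1 this).some
  have hne : Nonempty ι := Fintype.card_pos_iff.1 (by omega)
  have hz : ∀ f : ι → κ, ∃ z ∈ convexHull ℝ (Set.range fun i => X i (f i)),
      ∀ y ∈ convexHull ℝ (Set.range fun i => X i (f i)), ‖z‖ ≤ ‖y‖ := by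
    intro f
    have hc : IsCompact (convexHull ℝ (Set.range fun i => X i (f i))) :=
      (Set.finite_range _).isCompact_convexHull ℝ
    obtain ⟨z, hz, hmin⟩ := hc.exists_isMinOn
      (convexHull_nonempty_iff.2 (Set.range_nonempty _)) continuous_norm.continuousOn
    exact ⟨z, hz, fun y hy => hmin hy⟩
  choose z hzm hzmin using hz
  -- Bárány's argument: take the rainbow hull closest to the origin. If it misses the origin, some
  -- colour is not needed for its nearest point, and exchanging that colour's point gets closer.
  obtain ⟨f, hf⟩ := Finite.exists_min fun f => ‖z f‖
  refine ⟨f, ?_⟩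
  by_cases h0 : z f = 0
  · exact h0 ▸ hzm f
  exfalso
  obtain ⟨i₀, hi₀⟩ := exists_mem_convexHull_image_compl_of_isMinOn_norm _ hι h0 (hzm f) (hzmin f)
  obtain ⟨k, hk⟩ : ∃ k, inner ℝ (z f) (X i₀ k) ≤ 0 := by
    by_contra! hpos
    have hsub : convexHull ℝ (Set.range (X i₀)) ⊆ {y | 0 < inner ℝ (z f) y} := by
      refine convexHull_min ?_ (convex_halfSpace_gt (innerₗ E (z f)).isLinear 0)
      rintro _ ⟨k, rfl⟩
      exact hpos k
    simpa using hsub (hX i₀)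
  have hsub : z f ∈ convexHull ℝ (Set.range fun i => X i (Function.update f i₀ k i)) := by
    refine convexHull_mono ?_ hi₀
    rintro _ ⟨i, hi, rfl⟩
    exact ⟨i, by simp [Function.update_of_ne hi]⟩
  have hmem : X i₀ k ∈ convexHull ℝ (Set.range fun i => X i (Function.update f i₀ k i)) :=
    subset_convexHull ℝ _ ⟨i₀, by simp⟩
  obtain ⟨y, hy, hlt⟩ := (convex_convexHull ℝ _).exists_norm_lt_of_inner_nonpos hsub hmem h0 hk
  exact absurd ((hf _).trans (hzmin _ y hy)) (not_le.2 hlt)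

/-- **Colorful Carathéodory theorem**. -/
theorem exists_zero_mem_convexHull_rainbow' {E : Type*} [NormedAddCommGroup E]
    [NormedSpace ℝ E] [FiniteDimensional ℝ E] {ι κ : Type*} [Fintype ι] [Finite κ]
    (X : ι → κ → E) (hι : Module.finrank ℝ E < Fintype.card ι)
    (hX : ∀ i, (0 : E) ∈ convexHull ℝ (Set.range (X i))) :
    ∃ f : ι → κ, (0 : E) ∈ convexHull ℝ (Set.range fun i => X i (f i)) := by
  let T : E →ₗ[ℝ] EuclideanSpace ℝ (Fin (Module.finrank ℝ E)) :=
    (toEuclidean (E := E)).toLinearEquiv.toLinearMap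
  obtain ⟨f, hf⟩ := exists_zero_mem_convexHull_rainbow (fun i k => T (X i k))
    (by simpa using hι) (fun i => by
      have := Set.mem_image_of_mem T (hX i)
      rwa [T.image_convexHull, ← Set.range_comp, map_zero] at this)
  refine ⟨f, ?_⟩
  have hr : (Set.range fun i => T (X i (f i))) = T '' Set.range fun i => X i (f i) := by
    rw [← Set.range_comp]; rfl
  rw [hr, ← T.image_convexHull] at hf
  obtain ⟨y, hy, hy0⟩ := hf
  have : y = 0 := (toEuclidean (E := E)).toLinearEquiv.map_eq_zero_iff.1 hy0
  exact this ▸ hy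

/-! ### Tverberg's theorem -/

theorem exists_sum_smul_eq_of_mem_convexHull_range {E : Type*} [AddCommGroup E] [Module ℝ E]
    {ι : Type*} [Fintype ι] {v : ι → E} {x : E} (hx : x ∈ convexHull ℝ (Set.range v)) :
    ∃ w : ι → ℝ, (∀ i, 0 ≤ w i) ∧ ∑ i, w i = 1 ∧ ∑ i, w i • v i = x := by
  classical
  have hsub : convexHull ℝ (Set.range v) ⊆ Fintype.linearCombination ℝ v '' stdSimplex ℝ ι := by
    refine convexHull_min ?_ ((convex_stdSimplex ℝ ι).linear_image _)
    rintro _ ⟨i, rfl⟩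
    exact ⟨Pi.single i 1, single_mem_stdSimplex ℝ i, by simp⟩
  obtain ⟨w, ⟨hw0, hw1⟩, hwx⟩ := hsub hx
  exact ⟨w, hw0, hw1, by rw [← hwx, Fintype.linearCombination_apply]⟩

/-- **Tverberg's theorem**. -/
theorem exists_tverberg_partition {V : Type*} [NormedAddCommGroup V] [NormedSpace ℝ V]
    [FiniteDimensional ℝ V] {ι : Type*} [Fintype ι] (r : ℕ) (hr : 0 < r)
    (hι : (r - 1) * (Module.finrank ℝ V + 1) < Fintype.card ι) (a : ι → V) :
    ∃ (f : ι → Fin r) (x : V), ∀ j, x ∈ convexHull ℝ (a '' (f ⁻¹' {j})) := by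
  classical
  obtain ⟨s, rfl⟩ : ∃ s, r = s + 1 := ⟨r - 1, by omega⟩
  -- Sarkaria's trick: `X i j` is `(a i, 1) ⊗ u j`, where the `u j` are the basis of `ℝˢ` and minus
  -- its sum. They sum to zero, and every linear relation among them has equal coefficients.
  let X : ι → Fin (s + 1) → (Fin s → V × ℝ) := fun i j k =>
    (if j = k.castSucc then (a i, (1 : ℝ)) else 0) - if j = Fin.last s then (a i, (1 : ℝ)) else 0
  obtain ⟨f, hf⟩ := exists_zero_mem_convexHull_rainbow' X
    (by simpa [Module.finrank_pi_fintype] using hι) (fun i => by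
      have h0 : ∑ j, (1 / (s + 1 : ℝ)) • X i j = 0 := by
        rw [← Finset.smul_sum]
        convert smul_zero _
        ext1 k
        simp only [Finset.sum_apply, X, Finset.sum_sub_distrib, Finset.sum_ite_eq',
          Finset.mem_univ, if_true, sub_self, Pi.zero_apply]
      rw [← h0]
      refine (convex_convexHull ℝ _).sum_mem (fun _ _ => by positivity) ?_
        fun j _ => subset_convexHull ℝ _ ⟨j, rfl⟩
      simp
      field_simp)
  obtain ⟨w, hw0, hw1, hw⟩ := exists_sum_smul_eq_of_mem_convexHull_range hf
  let W : Fin (s + 1) → V × ℝ := fun j => ∑ i with f i = j, w i • (a i, (1 : ℝ))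
  -- The relation forces equal coefficients `W j`; the last coordinate makes the colour classes
  -- equal in weight, so their centres of mass coincide.
  have hW : ∀ j, W j = W (Fin.last s) := by
    intro j
    induction j using Fin.lastCases with
    | last => rfl
    | cast k =>
      have := congrFun hw k
      simp only [Finset.sum_apply, Pi.smul_apply, X, smul_sub, Finset.sum_sub_distrib, smul_ite,
        smul_zero, ← Finset.sum_filter, Pi.zero_apply] at this
      exact sub_eq_zero.1 this
  have hW2 : ∀ j, (W j).2 = ∑ i with f i = j, w i := fun j => by simp [W, Prod.snd_sum]
  have hW1 : ∀ j, (W j).1 = ∑ i with f i = j, w i • a i := fun j => by simp [W, Prod.fst_sum]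
  have htot : ∑ j, (W j).2 = 1 := by
    simp only [hW2]
    rw [Finset.sum_fiberwise, hw1]
  simp only [hW, Finset.sum_const, Finset.card_univ, Fintype.card_fin, nsmul_eq_mul] at htot
  have hpos : 0 < (W (Fin.last s)).2 := by
    by_contra! hle
    have : ((s + 1 : ℕ) : ℝ) * (W (Fin.last s)).2 ≤ 0 :=
      mul_nonpos_of_nonneg_of_nonpos (by positivity) hle
    linarith
  refine ⟨f, (W (Fin.last s)).2⁻¹ • (W (Fin.last s)).1, fun j => ?_⟩
  rw [← hW j] at hpos ⊢
  rw [hW1, hW2] at *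
  exact Finset.centerMass_mem_convexHull _ (fun i _ => hw0 i) hpos
    fun i hi => ⟨i, by simpa using hi, rfl⟩

/-! ### Approximate John theorem -/

/-- `(1 + t) * b ^ (n - 1)` is the volume gain of an ellipsoid stretched to `1 + t` along one axis
and shrunk to `b` along the others. To first order it is `1 + t (h - n) / (h - 1)`, a gain because
`h > n`; the choice of `t` keeps the higher-order terms harmless. -/
theorem exists_ellipsoid_params {n : ℕ} (hn : 0 < n) {h : ℝ} (hh : (n : ℝ) < h) :
    ∃ t b : ℝ, 0 < t ∧ 0 < b ∧ 2 * t < h - 1 ∧ b ^ 2 * (h - 1) = h - 1 - 2 * t ∧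
      1 < (1 + t) * b ^ (n - 1) := by
  have hn1 : (1 : ℝ) ≤ n := by exact_mod_cast hn
  have hh0 : 0 < h - 1 := by linarith
  set t : ℝ := (h - n) / (4 * h) with ht
  have h4 : t * (4 * h) = h - n := by
    have : h ≠ 0 := by linarith
    rw [ht]; field_simp
  have ht0 : 0 < t := div_pos (by linarith) (by linarith)
  have ht1 : 2 * t < h - 1 := by nlinarith
  set u : ℝ := 2 * t / (h - 1) with hu
  have hu' : u * (h - 1) = 2 * t := by rw [hu]; field_simp
  have hu0 : 0 < u := by positivity
  have hu1 : u < 1 := by rw [hu, div_lt_one hh0]; exact ht1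
  refine ⟨t, √(1 - u), ht0, Real.sqrt_pos.2 (by linarith), ht1, ?_, ?_⟩
  · rw [Real.sq_sqrt (by linarith)]; linarith
  have hbern : 1 + ((n - 1 : ℕ) : ℝ) * (-u) ≤ (1 + -u) ^ (n - 1) :=
    one_add_mul_le_pow (by linarith) _
  rw [Nat.cast_sub hn, Nat.cast_one] at hbern
  have hsq : 1 < ((1 + t) * √(1 - u) ^ (n - 1)) ^ 2 := by
    rw [mul_pow, ← pow_mul, mul_comm (n - 1) 2, pow_mul, Real.sq_sqrt (by linarith)]
    rw [← sub_eq_add_neg] at hbern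
    have hnn : ((n : ℝ) - 1) * u = 2 * t * ((n - 1) / (h - 1)) := by rw [hu]; ring
    set δ : ℝ := ((n : ℝ) - 1) / (h - 1) with hδ
    have hδ' : δ * (h - 1) = n - 1 := by rw [hδ]; field_simp
    have hδ0 : 0 ≤ δ := div_nonneg (by linarith) hh0.le
    have hδ1 : δ < 1 := by rw [hδ, div_lt_one hh0]; linarith
    have ht2 : 4 * t ≤ 1 - δ := by
      have : (1 - δ) * (h - 1) = 4 * t * h := by linarith
      nlinarith
    calc (1 : ℝ) < (1 + t) ^ 2 * (1 - 2 * t * δ) := by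
          nlinarith [mul_pos ht0 ht0, mul_nonneg ht0.le hδ0,
            mul_nonneg (mul_pos ht0 ht0).le hδ0]
      _ ≤ (1 + t) ^ 2 * (1 - u) ^ (n - 1) := by
        refine mul_le_mul_of_nonneg_left ?_ (sq_nonneg _)
        linarith
  exact lt_of_pow_lt_pow_left₀ 2 (by positivity) (by simpa using hsq)

/-- The cone step in John's theorem: a convex set containing the unit ball and the point `h • e`
contains the ellipsoid centred at `t • e` with semi-axes `1 + t` (along `e`) and `b`. -/
theorem Convex.add_smul_mem_of_closedBall_subset {E : Type*} [NormedAddCommGroup E]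
    [InnerProductSpace ℝ E] {K : Set E} (hK : Convex ℝ K) (hB : Metric.closedBall 0 1 ⊆ K)
    {e : E} (he : ‖e‖ = 1) {h t b : ℝ} (hhe : h • e ∈ K) (hh : 1 < h) (ht : 0 < t)
    (hth : 2 * t < h - 1) (hb : b ^ 2 * (h - 1) = h - 1 - 2 * t) {x : E} (hx : ‖x‖ ≤ 1) :
    t • e + (b • x + ((1 + t - b) * inner ℝ e x) • e) ∈ K := by
  set s := inner ℝ e x with hs
  have hee : inner ℝ e e = (1 : ℝ) := by rw [real_inner_self_eq_norm_sq, he]; norm_num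
  have hxx : inner ℝ x x ≤ (1 : ℝ) := by
    rw [real_inner_self_eq_norm_sq]; exact pow_le_one₀ (norm_nonneg _) hx
  have hxe : inner ℝ x e = s := real_inner_comm _ _
  have hs2 : |s| ≤ 1 := by
    have := abs_real_inner_le_norm e x
    rw [he, one_mul] at this
    exact this.trans hx
  obtain ⟨hs1, hs1'⟩ := abs_le.1 hs2
  set y := t • e + (b • x + ((1 + t - b) * s) • e) with hy
  have hnorm : ∀ c : ℝ, ‖y - c • e‖ ^ 2 =
      (t + (1 + t) * s - c) ^ 2 + b ^ 2 * (inner ℝ x x - s ^ 2) := by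
    intro c
    rw [← real_inner_self_eq_norm_sq]
    simp only [hy, inner_sub_left, inner_sub_right, inner_add_left, inner_add_right,
      inner_smul_left, inner_smul_right, hee, hxe, ← hs, RCLike.conj_to_real]
    ring
  have hb2 : b ^ 2 * (inner ℝ x x - s ^ 2) ≤ b ^ 2 * (1 - s ^ 2) :=
    mul_le_mul_of_nonneg_left (by linarith) (sq_nonneg b)
  have hα : t + (1 + t) * s < h := by nlinarith
  -- The tangent cone from `h • e` touches the unit ball at height `1 / h` along `e`. Below that
  -- height `y` lies in the ball; above it, in the cone.
  by_cases hc : h * (t + (1 + t) * s) ≤ 1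
  · apply hB
    rw [mem_closedBall_zero_iff]
    have h1 : ‖y‖ ^ 2 ≤ 1 := by
      have := hnorm 0
      simp only [zero_smul, sub_zero] at this
      rw [this]
      refine (add_le_add_right hb2 _).trans ?_
      -- The factor `s + 1` reflects that ellipsoid and ball touch at `-e`.
      have key : (s + 1) * (((1 + t) ^ 2 - b ^ 2) * s + (t ^ 2 + b ^ 2 - 1)) ≤ 0 := by
        refine mul_nonpos_of_nonneg_of_nonpos (by linarith) ?_
        obtain ⟨u, hu⟩ : ∃ u, u = 2 * t / (h - 1) := ⟨_, rfl⟩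
        have hu' : u * (h - 1) = 2 * t := by rw [hu]; exact div_mul_cancel₀ _ (by linarith)
        have hbu : b ^ 2 = 1 - u := by
          have : (b ^ 2 - (1 - u)) * (h - 1) = 0 := by linarith
          rcases mul_eq_zero.1 this with h0 | h0
          · linarith
          · linarith
        have hu0 : 0 < u := by rw [hu]; positivity
        rw [hbu]
        have hp : 0 < h * (1 + t) := by positivity
        have h1 : h * (1 + t) * s ≤ 1 - h * t := by linarith
        have h2 : (2 * t + t ^ 2 + u) * (h * (1 + t) * s) ≤ (2 * t + t ^ 2 + u) * (1 - h * t) :=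
          mul_le_mul_of_nonneg_left h1 (by positivity)
        have h3 : (u - t ^ 2) * (1 + t) * h - (2 * t + t ^ 2 + u) * (1 - h * t) =
            (u * (h - 1) - 2 * t) + 2 * u * h * t + t ^ 2 * (h - 1) := by ring
        have h4 : 0 ≤ 2 * u * h * t + t ^ 2 * (h - 1) :=
          add_nonneg (by positivity) (mul_nonneg (sq_nonneg t) (by linarith))
        refine nonpos_of_mul_nonpos_right ?_ hp
        linarith
      nlinarith
    exact (sq_le_one_iff₀ (norm_nonneg y)).1 h1
  · push Not at hc
    -- `lam` maximises `(1 - lam)² - (α - lam h)²`, with `α` the height of `y`: it is the best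
    -- weight on the apex for writing `y` as a combination of `h • e` and a point of the ball.
    set lam := (h * (t + (1 + t) * s) - 1) / (h ^ 2 - 1) with hlam
    have hd : 0 < h ^ 2 - 1 := by nlinarith
    have hl0 : 0 ≤ lam := div_nonneg (by linarith) hd.le
    have hl1 : lam < 1 := by rw [hlam, div_lt_one hd]; nlinarith
    have hl' : lam * (h ^ 2 - 1) = h * (t + (1 + t) * s) - 1 := by rw [hlam]; field_simp
    have h1 : ‖y - (lam * h) • e‖ ^ 2 ≤ (1 - lam) ^ 2 := by
      rw [hnorm]
      refine (add_le_add_right hb2 _).trans ?_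
      set α := t + (1 + t) * s with hαd
      have hsq : b ^ 2 * (1 - s ^ 2) * (h ^ 2 - 1) ≤ (h - α) ^ 2 := by
        have : b ^ 2 * (1 - s ^ 2) * (h ^ 2 - 1) = (h - 1 - 2 * t) * (h + 1) * (1 - s ^ 2) := by
          rw [← hb]; ring
        rw [this]
        have : (h - α) ^ 2 - (h - 1 - 2 * t) * (h + 1) * (1 - s ^ 2)
          = ((h - t) * s - (1 + t)) ^ 2 := by rw [hαd]; ring
        nlinarith [sq_nonneg ((h - t) * s - (1 + t))]
      have h2 : ((1 - lam) ^ 2 - (α - lam * h) ^ 2) * (h ^ 2 - 1) = (h - α) ^ 2 := by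
        have e1 : (1 - lam) ^ 2 - (α - lam * h) ^ 2
          = 1 - α ^ 2 + 2 * lam * (h * α - 1) - lam * (lam * (h ^ 2 - 1)) := by ring
        rw [e1, hl']
        have : (1 - α ^ 2 + 2 * lam * (h * α - 1) - lam * (h * α - 1)) * (h ^ 2 - 1)
          = (1 - α ^ 2) * (h ^ 2 - 1) + (lam * (h ^ 2 - 1)) * (h * α - 1) := by ring
        rw [this, hl']; ring
      have h3 : b ^ 2 * (1 - s ^ 2) ≤ (1 - lam) ^ 2 - (α - lam * h) ^ 2 :=
        le_of_mul_le_mul_right (by linarith) hd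
      linarith
    have h2 : ‖y - (lam * h) • e‖ ≤ 1 - lam :=
      (pow_le_pow_iff_left₀ (norm_nonneg _) (by linarith) two_ne_zero).1 h1
    have hz : (1 - lam)⁻¹ • (y - (lam * h) • e) ∈ K := by
      apply hB
      rw [mem_closedBall_zero_iff, norm_smul, norm_inv, Real.norm_of_nonneg (by linarith),
        inv_mul_le_iff₀ (by linarith), mul_one]
      exact h2
    have := hK hz hhe (by linarith : 0 ≤ 1 - lam) hl0 (by ring)
    rwa [smul_smul, mul_inv_cancel₀ (by linarith), one_smul, smul_smul, sub_add_cancel] at this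

/-- The map is `c` on `e` and `b` on its orthogonal complement; dividing by `b` leaves a
transvection. -/
theorem det_smul_id_add_inner_smul {E : Type*} [NormedAddCommGroup E]
    [InnerProductSpace ℝ E] [FiniteDimensional ℝ E] [Nontrivial E] {e : E} (he : ‖e‖ = 1) {b c : ℝ}
    (hb : b ≠ 0) :
    LinearMap.det (b • LinearMap.id + (innerₗ E e).smulRight ((c - b) • e)) =
      c * b ^ (Module.finrank ℝ E - 1) := by
  have hee : inner ℝ e e = (1 : ℝ) := by rw [real_inner_self_eq_norm_sq, he]; norm_num
  have : b • LinearMap.id + (innerₗ E e).smulRight ((c - b) • e) =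
      b • LinearMap.transvection (innerₗ E e) (b⁻¹ • (c - b) • e) := by
    ext x
    simp only [LinearMap.add_apply, LinearMap.smul_apply, LinearMap.id_apply,
      LinearMap.smulRight_apply, LinearMap.transvection.apply, smul_add, smul_smul]
    congr 2
    field_simp
  rw [this, LinearMap.det_smul, LinearMap.transvection.det]
  simp only [map_smul, innerₗ_apply_apply, hee, smul_eq_mul]
  obtain ⟨n, hn⟩ : ∃ n, Module.finrank ℝ E = n + 1 :=
    ⟨_, (Nat.succ_pred_eq_of_pos Module.finrank_pos).symm⟩
  rw [hn, Nat.add_sub_cancel, pow_succ]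
  field_simp
  ring

theorem Convex.interior_nonempty_of_measure_ne_zero {E : Type*} [NormedAddCommGroup E]
    [NormedSpace ℝ E] [MeasurableSpace E] [BorelSpace E] [FiniteDimensional ℝ E] (μ : Measure E)
    [μ.IsAddHaarMeasure] {K : Set E} (hK : Convex ℝ K) (h0 : μ K ≠ 0) : (interior K).Nonempty := by
  rw [hK.interior_nonempty_iff_affineSpan_eq_top]
  by_contra hne
  exact h0 (measure_mono_null (subset_affineSpan ℝ K) (Measure.addHaar_affineSubspace μ _ hne))

theorem MeasureTheory.Measure.addHaar_image_add_linearMap {E : Type*} [NormedAddCommGroup E]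
    [NormedSpace ℝ E] [MeasurableSpace E] [BorelSpace E] [FiniteDimensional ℝ E] (μ : Measure E)
    [μ.IsAddHaarMeasure] (c : E) (A : E →ₗ[ℝ] E) (s : Set E) :
    μ ((fun x => c + A x) '' s) = ENNReal.ofReal |LinearMap.det A| * μ s := by
  rw [← Measure.addHaar_image_linearMap, ← measure_preimage_add_right μ c]
  congr 1
  ext y
  simp only [Set.mem_image, Set.mem_preimage]
  refine exists_congr fun x => and_congr_right fun _ => ?_
  rw [add_comm, _root_.add_left_inj]

/-- If the convex set `K` contains the ellipsoid `c + A B` but is not contained in its dilate by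
`h > dim E`, then it contains an ellipsoid of larger volume, by a factor
depending only on `h`. -/
theorem Convex.exists_larger_ellipsoid {E : Type*} [NormedAddCommGroup E] [InnerProductSpace ℝ E]
    [FiniteDimensional ℝ E] [Nontrivial E] {K : Set E} (hK : Convex ℝ K) {A : E →ₗ[ℝ] E}
    (hA : LinearMap.det A ≠ 0) {c : E} (hAK : ∀ x, ‖x‖ ≤ 1 → c + A x ∈ K) {h t b : ℝ} (hh : 1 < h)
    (ht : 0 < t) (hb0 : 0 < b) (hth : 2 * t < h - 1) (hb : b ^ 2 * (h - 1) = h - 1 - 2 * t)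
    (hKh : ¬ K ⊆ (fun x => c + A x) '' Metric.closedBall 0 h) :
    ∃ (A' : E →ₗ[ℝ] E) (c' : E), (∀ x, ‖x‖ ≤ 1 → c' + A' x ∈ K) ∧
      LinearMap.det A' = LinearMap.det A * ((1 + t) * b ^ (Module.finrank ℝ E - 1)) := by
  obtain ⟨p, hpK, hp⟩ := Set.not_subset.1 hKh
  obtain ⟨q, hq⟩ : ∃ q, A q = p - c :=
    (LinearMap.equivOfDetNeZero A hA).surjective (p - c)
  have hqh : h < ‖q‖ := by
    by_contra! hle
    exact hp ⟨q, by simpa using hle, by simp [hq]⟩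
  have hq0 : 0 < ‖q‖ := by linarith
  have he : ‖‖q‖⁻¹ • q‖ = 1 := by
    rw [norm_smul, norm_inv, norm_norm, inv_mul_cancel₀ hq0.ne']
  set e := ‖q‖⁻¹ • q with hed
  -- In these coordinates the ellipsoid is the unit ball and `K` has a point farther than `h` from
  -- the origin.
  let K' : Set E := {x | c + A x ∈ K}
  have hK' : Convex ℝ K' := by
    intro x hx y hy u v hu hv huv
    have := hK hx hy hu hv huv
    change c + A (u • x + v • y) ∈ K
    convert this using 1
    rw [map_add, map_smul, map_smul]
    obtain rfl : v = 1 - u := by linarith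
    module
  have hB : Metric.closedBall 0 1 ⊆ K' := fun x hx => hAK x (by simpa using hx)
  have hqK : q ∈ K' := by
    change c + A q ∈ K
    rwa [hq, add_sub_cancel]
  have hhe : h • e ∈ K' := by
    rw [hed, smul_smul]
    exact hK'.smul_mem_of_zero_mem (hB (by simp)) hqK
      ⟨by positivity, by rw [← div_eq_mul_inv]; exact (div_le_one hq0).2 hqh.le⟩
  let M : E →ₗ[ℝ] E := b • LinearMap.id + (innerₗ E e).smulRight ((1 + t - b) • e)
  refine ⟨A ∘ₗ M, c + A (t • e), fun x hx => ?_, ?_⟩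
  · have := hK'.add_smul_mem_of_closedBall_subset hB he hhe hh ht hth hb hx
    change c + A _ ∈ K at this
    rw [map_add, ← add_assoc] at this
    convert this using 2
    simp [M, smul_smul, mul_comm]
  · rw [LinearMap.det_comp, det_smul_id_add_inner_smul he hb0.ne']

/-- An approximate form of **John's theorem**: a convex set contains an ellipsoid of volume at
least `h⁻ⁿ` times its own, for every `h` larger than the dimension `n`. -/
theorem Convex.exists_ellipsoid_subset {E : Type*} [NormedAddCommGroup E] [InnerProductSpace ℝ E]
    [FiniteDimensional ℝ E] [Nontrivial E] [MeasurableSpace E] [BorelSpace E] (μ : Measure E)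
    [μ.IsAddHaarMeasure] {K : Set E} (hK : Convex ℝ K) {m : ℝ} (hm : 0 < m)
    (hKm : ENNReal.ofReal m ≤ μ K) {h : ℝ} (hh : (Module.finrank ℝ E : ℝ) < h) :
    ∃ (A : E →ₗ[ℝ] E) (c : E), LinearMap.det A ≠ 0 ∧ (∀ x, ‖x‖ ≤ 1 → c + A x ∈ K) ∧
      m ≤ h ^ Module.finrank ℝ E * |LinearMap.det A| * μ.real (Metric.closedBall 0 1) := by
  have hn : 0 < Module.finrank ℝ E := Module.finrank_pos
  have hh1 : 1 < h := lt_of_le_of_lt (by exact_mod_cast hn) hh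
  have hh0 : 0 < h := by linarith
  obtain ⟨t, b, ht, hb0, hth, hb, hκ⟩ := exists_ellipsoid_params hn hh
  set ω := μ.real (Metric.closedBall (0 : E) 1) with hω
  have hω0 : 0 < ω :=
    ENNReal.toReal_pos (Metric.measure_closedBall_pos μ _ one_pos).ne' measure_closedBall_lt_top.ne
  let S : Set ℝ := {s | 0 < s ∧ ∃ (A : E →ₗ[ℝ] E) (c : E), |LinearMap.det A| = s ∧
    ∀ x, ‖x‖ ≤ 1 → c + A x ∈ K}
  have hS : S.Nonempty := by
    obtain ⟨c, hc⟩ := hK.interior_nonempty_of_measure_ne_zero μ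
      (lt_of_lt_of_le (ENNReal.ofReal_pos.2 hm) hKm).ne'
    obtain ⟨ε, hε, hεK⟩ := Metric.nhds_basis_closedBall.mem_iff.1 (mem_interior_iff_mem_nhds.1 hc)
    refine ⟨ε ^ Module.finrank ℝ E, by positivity, ε • LinearMap.id, c, ?_, fun x hx => hεK ?_⟩
    · rw [LinearMap.det_smul, LinearMap.det_id, mul_one, abs_of_pos (by positivity)]
    · simp only [LinearMap.smul_apply, LinearMap.id_apply, mem_closedBall_iff_norm,
        add_sub_cancel_left, norm_smul, Real.norm_of_nonneg hε.le]
      exact mul_le_of_le_one_right hε.le hx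
  -- No maximal ellipsoid is needed: one within the gain factor of the supremum cannot be enlarged,
  -- so its `h`-dilate covers `K`. If the volumes are unbounded, any large ellipsoid will do.
  by_cases hbdd : BddAbove S
  · have hsup : 0 < sSup S := by
      obtain ⟨s, hs⟩ := hS
      exact hs.1.trans_le (le_csSup hbdd hs)
    obtain ⟨s, ⟨hs0, A, c, hAs, hAK⟩, hs⟩ := exists_lt_of_lt_csSup hS (div_lt_self hsup hκ)
    rw [div_lt_iff₀ (by positivity)] at hs
    have hA : LinearMap.det A ≠ 0 := abs_pos.1 (hAs ▸ hs0)
    refine ⟨A, c, hA, hAK, ?_⟩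
    have hsub : K ⊆ (fun x => c + A x) '' Metric.closedBall 0 h := by
      by_contra hKh
      obtain ⟨A', c', hA', hdet⟩ := hK.exists_larger_ellipsoid hA hAK hh1 ht hb0 hth hb hKh
      have habs : |LinearMap.det A'| = s * ((1 + t) * b ^ (Module.finrank ℝ E - 1)) := by
        rw [hdet, abs_mul, hAs, abs_of_pos (by positivity)]
      exact absurd (le_csSup hbdd ⟨by positivity, A', c', habs, hA'⟩) (not_le.2 hs)
    have hle := hKm.trans (measure_mono hsub)
    rw [Measure.addHaar_image_add_linearMap, Measure.addHaar_closedBall' μ _ hh0.le,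
      ← ofReal_measureReal measure_closedBall_lt_top.ne, ← ENNReal.ofReal_mul (by positivity),
      ← ENNReal.ofReal_mul (by positivity)] at hle
    have := (ENNReal.ofReal_le_ofReal_iff (by positivity)).1 hle
    linarith
  · rw [not_bddAbove_iff] at hbdd
    obtain ⟨s, ⟨hs0, A, c, hAs, hAK⟩, hs⟩ := hbdd (m / (h ^ Module.finrank ℝ E * ω))
    refine ⟨A, c, abs_pos.1 (hAs ▸ hs0), hAK, ?_⟩
    rw [div_lt_iff₀ (by positivity)] at hs
    rw [hAs]
    linarith

/-! ### Ellipsoids parametrised by triangular matrices -/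

/-- Every ellipsoid is the image of the unit ball under an affine map with lower triangular
linear part. -/
theorem exists_lowerTriangular_of_det_ne_zero {d : ℕ}
    (A : EuclideanSpace ℝ (Fin d) →ₗ[ℝ] EuclideanSpace ℝ (Fin d)) (hA : LinearMap.det A ≠ 0) :
    ∃ L : Matrix (Fin d) (Fin d) ℝ, (∀ i j, i < j → L i j = 0) ∧ (∀ i, 0 < L i i) ∧
      ∏ i, L i i = |LinearMap.det A| ∧
      ∀ x : EuclideanSpace ℝ (Fin d), ∃ y, ‖y‖ = ‖x‖ ∧ A y = L.toEuclideanLin x := by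
  let e := EuclideanSpace.basisFun (Fin d) ℝ
  -- LQ decomposition: Gram–Schmidt on the rows of `A`. The orthogonal factor preserves norms, hence
  -- the unit ball.
  let f : Fin d → EuclideanSpace ℝ (Fin d) := fun i => LinearMap.adjoint A (e i)
  let b := InnerProductSpace.gramSchmidtOrthonormalBasis (𝕜 := ℝ) (by simp) f
  have hprod : |∏ i, inner ℝ (b i) (f i)| = |LinearMap.det A| := by
    rw [← InnerProductSpace.gramSchmidtOrthonormalBasis_det]
    change |b.toBasis.det (LinearMap.adjoint A ∘ e)| = _
    rw [Module.Basis.det_comp, abs_mul, ← Real.norm_eq_abs (b.toBasis.det e),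
      b.det_to_matrix_orthonormalBasis e, mul_one, ← LinearMap.det_toMatrix e.toBasis,
      LinearMap.toMatrix_adjoint, Matrix.conjTranspose_eq_transpose_of_trivial,
      Matrix.det_transpose, LinearMap.det_toMatrix]
  have hne : ∀ i, inner ℝ (b i) (f i) ≠ 0 := by
    have : ∏ i, inner ℝ (b i) (f i) ≠ 0 := abs_pos.1 (hprod ▸ abs_pos.2 hA)
    exact fun i => Finset.prod_ne_zero_iff.1 this i (Finset.mem_univ i)
  -- These signs make the diagonal positive and are absorbed into the orthogonal factor.
  let σ : Fin d → ℝ := fun j => SignType.sign (inner ℝ (b j) (f j))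
  have hσ : ∀ j, σ j ^ 2 = 1 := by
    intro j
    rcases lt_or_gt_of_ne (hne j) with h | h <;> simp [σ, h]
  refine ⟨Matrix.of fun i j => inner ℝ (b j) (f i) * σ j, fun i j hij => ?_, fun i => ?_, ?_,
    fun x => ⟨∑ j, (σ j * x j) • b j, ?_, ?_⟩⟩
  · simp only [Matrix.of_apply]
    rw [InnerProductSpace.gramSchmidtOrthonormalBasis_inv_triangular _ f hij, zero_mul]
  · simp only [Matrix.of_apply, σ, self_mul_sign]
    exact abs_pos.2 (hne i)
  · simp only [Matrix.of_apply, σ, self_mul_sign, ← Finset.abs_prod, hprod]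
  · rw [← sq_eq_sq₀ (norm_nonneg _) (norm_nonneg _), ← b.repr.norm_map, EuclideanSpace.norm_sq_eq,
      EuclideanSpace.norm_sq_eq]
    refine Finset.sum_congr rfl fun j _ => ?_
    rw [b.repr_apply_apply, b.orthonormal.inner_right_fintype]
    simp [mul_pow, hσ]
  · ext i
    rw [Matrix.toLpLin_apply]
    have : (A (∑ j, (σ j * x j) • b j)) i = inner ℝ (e i) (A (∑ j, (σ j * x j) • b j)) := by
      rw [EuclideanSpace.basisFun_inner]
    rw [this, ← LinearMap.adjoint_inner_left, inner_sum]
    simp only [inner_smul_right, Matrix.mulVec, dotProduct, Matrix.of_apply]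
    refine Finset.sum_congr rfl fun j _ => ?_
    rw [real_inner_comm]
    ring

/-- The positive vectors whose product of entries is at least `m` form a convex set. -/
theorem convex_setOf_le_prod {n : Type*} [Fintype n] {m : ℝ} (hm : 0 < m) :
    Convex ℝ {y : n → ℝ | (∀ i, 0 < y i) ∧ m ≤ ∏ i, y i} := by
  -- Logarithms turn the product bound into a bound on a sum of concave functions.
  have hlog : ∀ y : n → ℝ, (∀ i, 0 < y i) → (m ≤ ∏ i, y i ↔ Real.log m ≤ ∑ i, Real.log (y i)) := by
    intro y hy
    rw [← Real.log_prod fun i _ => (hy i).ne',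
      Real.log_le_log_iff hm (Finset.prod_pos fun i _ => hy i)]
  rintro x ⟨hx, hxm⟩ y ⟨hy, hym⟩ a b ha hb hab
  have hpos : ∀ i, 0 < (a • x + b • y) i := fun i =>
    convex_Ioi (0 : ℝ) (hx i) (hy i) ha hb hab
  refine ⟨hpos, ?_⟩
  rw [hlog _ ‹_›] at hxm hym ⊢
  calc Real.log m = a * Real.log m + b * Real.log m := by rw [← add_mul, hab, one_mul]
    _ ≤ a * ∑ i, Real.log (x i) + b * ∑ i, Real.log (y i) :=
      add_le_add (mul_le_mul_of_nonneg_left hxm ha) (mul_le_mul_of_nonneg_left hym hb)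
    _ = ∑ i, (a • Real.log (x i) + b • Real.log (y i)) := by
      simp only [Finset.mul_sum, Finset.sum_add_distrib, smul_eq_mul]
    _ ≤ ∑ i, Real.log ((a • x + b • y) i) := Finset.sum_le_sum fun i _ =>
      strictConcaveOn_log_Ioi.concaveOn.2 (hx i) (hy i) ha hb hab

/-- The lower triangular matrix with prescribed entries on and below the diagonal. -/
def lowerTriangularMatrix (d : ℕ) :
    ((i : Fin d) → Finset.Iic i → ℝ) →ₗ[ℝ] Matrix (Fin d) (Fin d) ℝ where
  toFun v := Matrix.of fun i j => if h : j ≤ i then v i ⟨j, Finset.mem_Iic.2 h⟩ else 0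
  map_add' v w := by
    ext i j
    by_cases h : j ≤ i <;> simp [h]
  map_smul' a v := by
    ext i j
    by_cases h : j ≤ i <;> simp [h]

theorem lowerTriangularMatrix_apply_of_lt {d : ℕ} (v : (i : Fin d) → Finset.Iic i → ℝ)
    {i j : Fin d} (h : i < j) : lowerTriangularMatrix d v i j = 0 := by
  simp [lowerTriangularMatrix, h]

theorem exists_lowerTriangularMatrix_eq {d : ℕ} (L : Matrix (Fin d) (Fin d) ℝ)
    (hL : ∀ i j, i < j → L i j = 0) : ∃ v, lowerTriangularMatrix d v = L := by
  refine ⟨fun i j => L i j, ?_⟩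
  ext i j
  by_cases h : j ≤ i
  · simp [lowerTriangularMatrix, h]
  · simp [lowerTriangularMatrix, h, hL i j (not_le.1 h)]

/-- The parameters of ellipsoids in `ℝᵈ`: a centre and a lower triangular matrix. -/
abbrev EllipsoidParam (d : ℕ) : Type :=
  EuclideanSpace ℝ (Fin d) × ((i : Fin d) → Finset.Iic i → ℝ)

theorem finrank_ellipsoidParam (d : ℕ) :
    Module.finrank ℝ (EllipsoidParam d) = d * (d + 3) / 2 := by
  have h1 : Module.finrank ℝ (EllipsoidParam d) = d + ∑ i ∈ Finset.range d, (i + 1) := by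
    simp [-Finset.mem_Iic, EllipsoidParam, Module.finrank_prod, Module.finrank_pi_fintype,
      ← Fin.sum_univ_eq_sum_range (fun i => i + 1)]
  have h2 := Finset.sum_range_id_mul_two (d + 1)
  rw [Finset.sum_range_succ', add_zero, Nat.add_sub_cancel] at h2
  rw [h1]
  symm
  apply Nat.div_eq_of_eq_mul_left two_pos
  rw [add_mul, h2]
  ring

/-- The parameters of ellipsoids contained in `K` whose volume is at least `m` times that of the
unit ball. -/
def ellipsoidsIn {d : ℕ} (K : Set (EuclideanSpace ℝ (Fin d))) (m : ℝ) : Set (EllipsoidParam d) :=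
  {v | ((∀ i, 0 < lowerTriangularMatrix d v.2 i i) ∧ m ≤ ∏ i, lowerTriangularMatrix d v.2 i i) ∧
    ∀ x, ‖x‖ ≤ 1 → v.1 + (lowerTriangularMatrix d v.2).toEuclideanLin x ∈ K}

theorem ellipsoidsIn_mono {d : ℕ} {K K' : Set (EuclideanSpace ℝ (Fin d))} (h : K ⊆ K') (m : ℝ) :
    ellipsoidsIn K m ⊆ ellipsoidsIn K' m := fun _ hv => ⟨hv.1, fun x hx => h (hv.2 x hx)⟩

/-- For fixed `x` the point `c + L x` is linear in `(c, L)`, so containment survives convex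
combinations. The volume bound does too, because a triangular determinant is the product of the
diagonal. -/
theorem Convex.convex_ellipsoidsIn {d : ℕ} {K : Set (EuclideanSpace ℝ (Fin d))} (hK : Convex ℝ K)
    {m : ℝ} (hm : 0 < m) : Convex ℝ (ellipsoidsIn K m) := by
  rintro v ⟨hv, hvK⟩ w ⟨hw, hwK⟩ a b ha hb hab
  refine ⟨?_, fun x hx => ?_⟩
  · have := convex_setOf_le_prod hm hv hw ha hb hab
    rw [Prod.snd_add, Prod.smul_snd, Prod.smul_snd, map_add, map_smul, map_smul]
    exact this
  · convert hK (hvK x hx) (hwK x hx) ha hb hab using 1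
    simp only [Prod.snd_add, Prod.smul_snd, Prod.fst_add, Prod.smul_fst, map_add, map_smul,
      LinearMap.add_apply, LinearMap.smul_apply]
    module

/-- The bound is normalised by the volume of the unit ball, so that it means ellipsoid volume at
least `h⁻ᵈ`. -/
theorem Convex.ellipsoidsIn_nonempty {d : ℕ} (hd : 0 < d) {K : Set (EuclideanSpace ℝ (Fin d))}
    (hK : Convex ℝ K) (hvol : 1 ≤ volume K) {h : ℝ} (hh : (d : ℝ) < h) :
    (ellipsoidsIn K
      (h ^ d * volume.real (Metric.closedBall (0 : EuclideanSpace ℝ (Fin d)) 1))⁻¹).Nonempty := by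
  have : Nonempty (Fin d) := ⟨⟨0, hd⟩⟩
  obtain ⟨A, c, hA, hAK, hvolA⟩ := hK.exists_ellipsoid_subset volume one_pos (by simpa using hvol)
    (h := h) (by simpa using hh)
  obtain ⟨L, hL0, hLpos, hLdet, hL⟩ := exists_lowerTriangular_of_det_ne_zero A hA
  obtain ⟨v, rfl⟩ := exists_lowerTriangularMatrix_eq L hL0
  refine ⟨(c, v), ⟨hLpos, ?_⟩, fun x hx => ?_⟩
  · rw [hLdet]
    have hh0 : 0 < h := (Nat.cast_nonneg d).trans_lt hh
    have hω : 0 < volume.real (Metric.closedBall (0 : EuclideanSpace ℝ (Fin d)) 1) :=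
      ENNReal.toReal_pos (Metric.measure_closedBall_pos volume _ one_pos).ne'
        measure_closedBall_lt_top.ne
    rw [inv_le_iff_one_le_mul₀ (by positivity)]
    rw [finrank_euclideanSpace_fin] at hvolA
    linarith
  · obtain ⟨y, hy, hyx⟩ := hL x
    rw [← hyx]
    exact hAK y (hy.trans_le hx)

theorem le_volume_of_mem_ellipsoidsIn {d : ℕ} {K : Set (EuclideanSpace ℝ (Fin d))} {m : ℝ}
    {v : EllipsoidParam d} (hv : v ∈ ellipsoidsIn K m) :
    ENNReal.ofReal (m * volume.real (Metric.closedBall (0 : EuclideanSpace ℝ (Fin d)) 1)) ≤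
      volume K := by
  obtain ⟨⟨hpos, hm⟩, hK⟩ := hv
  have hdet : LinearMap.det (lowerTriangularMatrix d v.2).toEuclideanLin =
      ∏ i, lowerTriangularMatrix d v.2 i i := by
    rw [Matrix.toEuclideanLin, LinearMap.det_toLpLin, Matrix.det_of_isLowerTriangular]
    exact fun i j hij => lowerTriangularMatrix_apply_of_lt _ hij
  calc _ ≤ ENNReal.ofReal (|LinearMap.det (lowerTriangularMatrix d v.2).toEuclideanLin| *
        volume.real (Metric.closedBall (0 : EuclideanSpace ℝ (Fin d)) 1)) := by
        refine ENNReal.ofReal_le_ofReal (mul_le_mul_of_nonneg_right ?_ measureReal_nonneg)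
        rw [hdet]
        exact hm.trans (le_abs_self _)
    _ = volume ((fun x => v.1 + (lowerTriangularMatrix d v.2).toEuclideanLin x) ''
        Metric.closedBall 0 1) := by
        rw [Measure.addHaar_image_add_linearMap, ENNReal.ofReal_mul (abs_nonneg _),
          ofReal_measureReal measure_closedBall_lt_top.ne]
    _ ≤ volume K := measure_mono (by
        rintro _ ⟨x, hx, rfl⟩
        exact hK x (by simpa using hx))

/-! ### Volumetric Tverberg theorem -/

/-- The volumetric Tverberg theorem with the constant `d⁻ᵈ` replaced by any `h⁻ᵈ`, `h > d`. -/
theorem exists_partition_le_volume_iInter_convexHull (r d : ℕ) (hr : 0 < r) (hd : 0 < d)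
    {ι : Type*} [Fintype ι]
    (hcard : (r - 1) * (d * (d + 3) / 2 + 1) < Fintype.card ι)
    (F : ι → Set (EuclideanSpace ℝ (Fin d))) (hF : ∀ i, 1 ≤ volume (F i)) {h : ℝ}
    (hh : (d : ℝ) < h) :
    ∃ f : ι → Fin r, Function.Surjective f ∧
      ENNReal.ofReal (h ^ (-(d : ℤ))) ≤
        volume (⋂ j, convexHull ℝ (⋃ i ∈ f ⁻¹' {j}, F i)) := by
  have hh0 : 0 < h := (Nat.cast_nonneg d).trans_lt hh
  have hω : 0 < volume.real (Metric.closedBall (0 : EuclideanSpace ℝ (Fin d)) 1) :=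
    ENNReal.toReal_pos (Metric.measure_closedBall_pos volume _ one_pos).ne'
      measure_closedBall_lt_top.ne
  choose a ha using fun i => (convex_convexHull ℝ (F i)).ellipsoidsIn_nonempty hd
    ((hF i).trans (measure_mono (subset_convexHull ℝ _))) hh
  obtain ⟨f, v, hfv⟩ := exists_tverberg_partition r hr
    (by rwa [finrank_ellipsoidParam]) a
  refine ⟨f, fun j => ?_, ?_⟩
  · obtain ⟨_, i, hi, -⟩ := convexHull_nonempty_iff.1 ⟨v, hfv j⟩
    exact ⟨i, hi⟩
  · have hmem : ∀ j, v ∈ ellipsoidsIn (convexHull ℝ (⋃ i ∈ f ⁻¹' {j}, F i))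
        (h ^ d * volume.real (Metric.closedBall (0 : EuclideanSpace ℝ (Fin d)) 1))⁻¹ := by
      intro j
      refine convexHull_min ?_ ((convex_convexHull ℝ _).convex_ellipsoidsIn (by positivity)) (hfv j)
      rintro _ ⟨i, hi, rfl⟩
      exact ellipsoidsIn_mono (convexHull_mono (Set.subset_biUnion_of_mem hi)) _ (ha i)
    have : Nonempty (Fin r) := ⟨⟨0, hr⟩⟩
    have hv : v ∈ ellipsoidsIn (⋂ j, convexHull ℝ (⋃ i ∈ f ⁻¹' {j}, F i))
        (h ^ d * volume.real (Metric.closedBall (0 : EuclideanSpace ℝ (Fin d)) 1))⁻¹ :=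
      ⟨(hmem ⟨0, hr⟩).1, fun x hx => Set.mem_iInter.2 fun j => (hmem j).2 x hx⟩
    refine le_trans (le_of_eq ?_) (le_volume_of_mem_ellipsoidsIn hv)
    rw [zpow_neg, zpow_natCast]
    congr 1
    field_simp

theorem mainTheorem7 (r d : ℕ) (hr : 0 < r) (hd : 0 < d)
    {ι : Type*} [Fintype ι]
    (hcard : Fintype.card ι = (r - 1) * (d * (d + 3) / 2 + 1) + 1)
    (F : ι → Set (EuclideanSpace ℝ (Fin d)))
    (hF : ∀ i, volume (F i) = 1) :
    ∃ A : Fin r → Set ι,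
      (∀ j, (A j).Nonempty) ∧
      Pairwise (fun j k => Disjoint (A j) (A k)) ∧
      (⋃ j, A j) = Set.univ ∧
      ENNReal.ofReal ((d : ℝ) ^ (-(d : ℤ))) ≤
        volume (⋂ j, convexHull ℝ (⋃ i ∈ A j, F i)) := by
  obtain ⟨f, hf, hvol⟩ : ∃ f : ι → Fin r, Function.Surjective f ∧
      ENNReal.ofReal ((d : ℝ) ^ (-(d : ℤ))) ≤
        volume (⋂ j, convexHull ℝ (⋃ i ∈ f ⁻¹' {j}, F i)) := by
    -- If every partition failed strictly at `d`, then by continuity and finiteness all would fail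
    -- at some `h > d` too.
    by_contra! hcon
    have hcont : ContinuousAt (fun h : ℝ => ENNReal.ofReal (h ^ (-(d : ℤ)))) d :=
      ENNReal.continuous_ofReal.continuousAt.comp
        (continuousAt_zpow₀ _ _ (Or.inl (by positivity)))
    have hev : ∀ᶠ h : ℝ in nhds (d : ℝ), ∀ f : ι → Fin r, Function.Surjective f →
        volume (⋂ j, convexHull ℝ (⋃ i ∈ f ⁻¹' {j}, F i)) < ENNReal.ofReal (h ^ (-(d : ℤ))) := by
      rw [Filter.eventually_all]
      intro f
      by_cases hf : Function.Surjective f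
      · simpa only [hf, forall_const] using hcont.eventually_const_lt (hcon f hf)
      · simp [hf]
    obtain ⟨h, hdh, hlt⟩ := ((hev.filter_mono nhdsWithin_le_nhds).and
      (self_mem_nhdsWithin : Set.Ioi (d : ℝ) ∈ nhdsWithin (d : ℝ) (Set.Ioi (d : ℝ)))).exists
    obtain ⟨f, hf, hle⟩ := exists_partition_le_volume_iInter_convexHull r d hr hd (by omega) F
      (fun i => (hF i).ge) hlt
    exact absurd hle (not_le.2 (hdh f hf))
  refine ⟨fun j => f ⁻¹' {j}, fun j => hf j, fun j k hjk => ?_, ?_, hvol⟩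
  · exact Disjoint.preimage f (Set.disjoint_singleton.2 hjk)
  · rw [← Set.preimage_iUnion, Set.iUnion_of_singleton, Set.preimage_univ]
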